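/- For a finite simple graph $G$ and a vertex $v$, let $N[v]$ be the closed neighbourhood of $v$, consisting of $v$ and all vertices adjacent to $v$. A labeling $f$ of $V(G)$ by positive integers is called vertex sum-distinguishing if $\sum_{x\in N[u]} f(x)\neq \sum_{x\in N[v]} f(x)$ for all vertices $u,v$ with $N[u]\neq N[v]$. Let $s^*(G)$ be the least integer $k$ such that $G$ has a vertex sum-distinguishing labeling with largest label $k$, and let $s^*(n)$ be the maximum of $s^*(G)$ over all graphs $G$ with $n$ vertices. For all real $C>0$ and $\varepsilon>0$ there is $n_0$ such that for every $n>n_0$, $$n^{2-\varepsilon}\le s^*(n)\le \frac{n^2}{C}.$$ In other words, there is a positive function $w$ on the positive integers such that $s^*(n)=n^2/w(n)$ for all $n\ge 1$, $w(n)\to\infty$ as $n\to\infty$, and $w(n)=o(n^{\varepsilon})$ for every $\varepsilon>0$. -/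

import Mathlib

open Filter Asymptotics

namespace SumDistinguishing

variable {V : Type*} [Fintype V]

open Classical in
/-- The closed neighbourhood `N[v]`: the vertex `v` together with all vertices adjacent to it. -/
noncomputable def closedNeighborhood (G : SimpleGraph V) (v : V) : Finset V :=
  {u : V | u = v ∨ G.Adj v u}

/-- The sum of the labels over the closed neighbourhood of `v`. -/
noncomputable def closedSum (G : SimpleGraph V) (f : V → ℕ) (v : V) : ℕ :=
  ∑ x ∈ closedNeighborhood G v, f x

/-- A labeling by positive integers is vertex sum-distinguishing if vertices with different closed
neighbourhoods have different closed neighbourhood sums. -/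
def IsVertexSumDistinguishing (G : SimpleGraph V) (f : V → ℕ) : Prop :=
  (∀ v, 0 < f v) ∧
    ∀ u v, closedNeighborhood G u ≠ closedNeighborhood G v → closedSum G f u ≠ closedSum G f v

/-- `s*(G)`: the least `k` such that `G` has a vertex sum-distinguishing labeling whose largest
label is `k`. -/
noncomputable def sStarGraph (G : SimpleGraph V) : ℕ :=
  sInf {k : ℕ | ∃ f : V → ℕ, IsVertexSumDistinguishing G f ∧ IsGreatest (Set.range f) k}

/-- The minimum defining `s*(G)` is attained as soon as the graph has a vertex. -/
theorem sStarGraph_isLeast [Nonempty V] (G : SimpleGraph V) :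
    IsLeast {k : ℕ | ∃ f : V → ℕ, IsVertexSumDistinguishing G f ∧ IsGreatest (Set.range f) k}
      (sStarGraph G) := by
  refine ⟨Nat.sInf_mem ?_, fun k hk => Nat.sInf_le hk⟩
  let e := Fintype.equivFin V
  let f : V → ℕ := fun v => 2 ^ (e v : ℕ)
  have hfin : (Set.range f).Finite := Set.finite_range f
  obtain ⟨k, hk⟩ := hfin.exists_maximal (Set.range_nonempty f)
  refine ⟨k, f, ⟨fun v => by positivity, fun u v huv hs => huv ?_⟩, hk.prop, ?_⟩
  · let i : V ↪ ℕ := ⟨fun v => (e v : ℕ), fun a b h => e.injective (Fin.ext h)⟩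
    apply Finset.map_injective i
    apply Finset.geomSum_injective (n := 2) le_rfl
    simp only [Finset.sum_map]
    exact hs
  · intro y hy
    rcases le_total y k with h | h
    · exact h
    · exact hk.le_of_ge hy h

open Classical in
/-- `s*(n)`: the maximum of `s*(G)` over all graphs `G` on `n` vertices. -/
noncomputable def sStar (n : ℕ) : ℕ :=
  (Finset.univ : Finset (SimpleGraph (Fin n))).sup sStarGraph

end SumDistinguishing

/-! Upper bound: fix a constant `C` and let `M` be of order `n ^ 2 / C`. Two closed neighbourhoods
give a linear equation for the labels, in as many variables as the size of their symmetric
difference. Among constantly many scales `D < (C + 1) * D < (C + 1) ^ 2 * D < ⋯`, pigeonhole finds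
one with few pairs at distance in `(D, (C + 1) * D]`. The at most `C * D` vertices that separate
more than `M` of the pairs at distance at most `D` are labelled by powers of two; the other labels
are chosen independently at random from `{1, …, 2 * M}`. Choosing them one after another avoids the
equations of the close pairs with probability at least a constant depending on `C`. By the union
bound the remaining equations do not spoil this: those at the chosen scale are few, and each of
those from further apart holds with probability at most `(D.choose (D / 2) / 2 ^ D) / M`, by the
Littlewood–Offord argument applied to the bits `b` when the labels are written as `y + M * b + 1`.

Lower bound: sums of `k ≈ 2 * log₂ n` labels at most `N` take fewer than `R = k * N + 1` values, so
among `3 * R` subsets of a `k`-set there are `R` disjoint pairs with equal sums. When the subsets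
are coloured at random with `q` colours, a fixed labelling fails to have a monochromatic such pair
in a given colour with probability at most `(1 - 1 / q ^ 2) ^ R`. This beats the number
`(N + 1) ^ k` of labellings as soon as `R` exceeds `q ^ 2` by a polylogarithmic factor, and then the
smallest colour class, realised by closed neighbourhoods, needs a label larger than `N`.
-/

namespace SumDistinguishing

open Finset
open scoped symmDiff

theorem card_mul_pow_le_of_card_fiber_le {V A : Type*} [Fintype V] [DecidableEq V] [Fintype A]
    [DecidableEq A] (S : Finset (V → A)) (T : Finset V) {K : ℕ}
    (h : ∀ g₀ : V → A, #{g ∈ S | ∀ x ∉ T, g x = g₀ x} ≤ K) :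
    #S * Fintype.card A ^ #T ≤ K * Fintype.card A ^ Fintype.card V := by
  let restrict : (V → A) → ({x // x ∉ T} → A) := fun g x => g x
  have hfiber : #S ≤ K * #(S.image restrict) := by
    refine card_le_mul_card_image _ _ fun r hr => ?_
    obtain ⟨g₀, -, rfl⟩ := mem_image.1 hr
    simpa [restrict, funext_iff] using h g₀
  have himage : #(S.image restrict) ≤ Fintype.card A ^ #Tᶜ := by
    simpa [Fintype.card_subtype_compl, card_compl] using card_le_univ (S.image restrict)
  calc #S * Fintype.card A ^ #T
      ≤ K * Fintype.card A ^ #Tᶜ * Fintype.card A ^ #T := by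
        gcongr; exact hfiber.trans (Nat.mul_le_mul_left K himage)
    _ = K * Fintype.card A ^ Fintype.card V := by
        rw [mul_assoc, ← pow_add, card_compl_add_card]

theorem card_mul_sub_le_card_filter_notMem {V A : Type*} [Fintype A] [DecidableEq V]
    [DecidableEq A] {G : Finset (V → A)} {B : (V → A) → Finset A} {j : V} {a : ℕ}
    (hG : ∀ g ∈ G, ∀ b, Function.update g j b ∈ G)
    (hB : ∀ g b, B (Function.update g j b) = B g) (hBa : ∀ g ∈ G, #(B g) ≤ a) :
    #G * (Fintype.card A - a) ≤ #{g ∈ G | g j ∉ B g} * Fintype.card A := by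
  calc #G * (Fintype.card A - a) ≤ ∑ g ∈ G, #(B g)ᶜ := by
        rw [← smul_eq_mul]
        refine card_nsmul_le_sum _ _ _ fun g hg => ?_
        rw [card_compl]
        exact Nat.sub_le_sub_left (hBa g hg) _
    _ = #(G.sigma fun g => (B g)ᶜ) := (card_sigma _ _).symm
    _ ≤ #({g ∈ G | g j ∉ B g} ×ˢ (univ : Finset A)) := by
        refine card_le_card_of_injOn (fun p => (Function.update p.1 j p.2, p.1 j)) ?_ ?_
        · rintro ⟨g, b⟩ h
          simp only [coe_sigma, Set.mem_sigma_iff, mem_coe, mem_compl] at h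
          simpa [hB, h.2] using hG g h.1 b
        · rintro ⟨g, b⟩ - ⟨g', b'⟩ - h
          have hupdate : Function.update g j b = Function.update g' j b' := (Prod.mk.inj h).1
          have hj : g j = g' j := (Prod.mk.inj h).2
          obtain rfl : b = b' := by simpa using congrFun hupdate j
          obtain rfl : g = g' := by
            have hrestored := congrArg (Function.update · j (g j)) hupdate
            simp only [Function.update_idem, Function.update_eq_self] at hrestored
            simpa only [hj, Function.update_eq_self] using hrestored
          rfl
    _ = #{g ∈ G | g j ∉ B g} * Fintype.card A := by rw [card_product, card_univ]

theorem prod_sub_le_card_forall_notMem {V A : Type*} [Fintype V] [LinearOrder V] [Fintype A]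
    [DecidableEq A] [Nonempty A] (B : V → (V → A) → Finset A) (a : V → ℕ)
    (hB : ∀ v g g', (∀ u < v, g u = g' u) → B v g = B v g') (hBa : ∀ v g, #(B v g) ≤ a v) :
    ∏ v, (Fintype.card A - a v) ≤ #{g : V → A | ∀ v, g v ∉ B v g} := by
  have hpartial (s : Finset V) : (∏ v ∈ s, (Fintype.card A - a v)) * Fintype.card (V → A) ≤
      #{g : V → A | ∀ v ∈ s, g v ∉ B v g} * Fintype.card A ^ #s := by
    induction s using Finset.induction_on_max with
    | empty => simp
    | insert j s hj ih =>
      have hjs : j ∉ s := fun h => (hj j h).false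
      have hBj (v) (hv : v ≤ j) (g : V → A) (b : A) : B v (Function.update g j b) = B v g :=
        hB v _ _ fun u hu => Function.update_of_ne (hu.trans_le hv).ne _ _
      have hresample := card_mul_sub_le_card_filter_notMem (B := B j)
        (G := {g : V → A | ∀ v ∈ s, g v ∉ B v g}) (j := j)
        (fun g hg b => by
          simp only [mem_filter, mem_univ, true_and] at hg ⊢
          intro v hv
          rw [hBj v (hj v hv).le, Function.update_of_ne (hj v hv).ne]
          exact hg v hv)
        (hBj j le_rfl) (fun g _ => hBa j g)
      rw [filter_filter] at hresample
      calc (∏ v ∈ insert j s, (Fintype.card A - a v)) * Fintype.card (V → A)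
          = (∏ v ∈ s, (Fintype.card A - a v)) * Fintype.card (V → A) *
              (Fintype.card A - a j) := by rw [prod_insert hjs]; ring
        _ ≤ #{g : V → A | ∀ v ∈ s, g v ∉ B v g} * (Fintype.card A - a j) *
              Fintype.card A ^ #s := by linarith [Nat.mul_le_mul_right (Fintype.card A - a j) ih]
        _ ≤ #{g : V → A | ∀ v ∈ insert j s, g v ∉ B v g} * Fintype.card A *
              Fintype.card A ^ #s := by
          refine Nat.mul_le_mul_right _ ?_
          simpa only [forall_mem_insert, and_comm] using hresample
        _ = _ := by rw [card_insert_of_notMem hjs]; ring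
  refine Nat.le_of_mul_le_mul_right ?_ (Fintype.card_pos (α := V → A))
  simpa using hpartial univ

theorem sum_abs_symmDiff {V R : Type*} [DecidableEq V] [AddCommGroup R] [LinearOrder R]
    [IsOrderedAddMonoid R] [Fintype V] (c : V → R) (P : Finset V) :
    ∑ x ∈ P ∆ ({x | c x < 0} : Finset V), |c x| = ∑ x ∈ P, c x + ∑ x with c x < 0, |c x| := by
  rw [← Fintype.sum_ite_mem (_ ∆ _), ← Fintype.sum_ite_mem P,
    ← Fintype.sum_ite_mem (filter _ _), ← sum_add_distrib]
  refine sum_congr rfl fun x _ => ?_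
  obtain h | h := lt_or_ge (c x) 0
  · by_cases hP : x ∈ P <;> simp [mem_symmDiff, hP, h, abs_of_neg]
  · by_cases hP : x ∈ P <;> simp [mem_symmDiff, hP, h, abs_of_nonneg, h.not_gt]

theorem card_filter_sum_eq_le_choose {V R : Type*} [Fintype V] [AddCommGroup R] [LinearOrder R]
    [IsOrderedAddMonoid R] {c : V → R} (hc : ∀ x, c x ≠ 0) (s : R) :
    #{P : Finset V | ∑ x ∈ P, c x = s} ≤ (Fintype.card V).choose (Fintype.card V / 2) := by
  classical
  set Q : Finset V := {x | c x < 0} with hQ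
  have hantichain : IsAntichain (· ⊆ ·)
      (({P : Finset V | ∑ x ∈ P, c x = s} : Finset _).image (· ∆ Q) : Set (Finset V)) := by
    rw [coe_image]
    rintro _ ⟨P, hP, rfl⟩ _ ⟨P', hP', rfl⟩ hne hsub
    have hlt : ∑ x ∈ P ∆ Q, |c x| < ∑ x ∈ P' ∆ Q, |c x| := by
      obtain ⟨x, hx', hx⟩ := exists_of_ssubset (ssubset_of_subset_of_ne hsub hne)
      exact sum_lt_sum_of_subset hsub hx' hx (abs_pos.2 (hc x)) fun y _ _ => abs_nonneg _
    rw [hQ, sum_abs_symmDiff, sum_abs_symmDiff] at hlt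
    simp_all
  simpa [card_image_of_injective _ (symmDiff_left_injective Q)] using hantichain.sperner

theorem centralBinom_sq_mul_le (h : ℕ) : h.centralBinom ^ 2 * (2 * h + 1) ≤ 16 ^ h := by
  induction h with
  | zero => simp
  | succ h ih =>
    refine Nat.le_of_mul_le_mul_left ?_ (show 0 < (h + 1) ^ 2 by positivity)
    calc (h + 1) ^ 2 * ((h + 1).centralBinom ^ 2 * (2 * (h + 1) + 1))
        = ((h + 1) * (h + 1).centralBinom) ^ 2 * (2 * h + 3) := by ring
      _ = h.centralBinom ^ 2 * (2 * h + 1) * (4 * ((2 * h + 1) * (2 * h + 3))) := by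
        rw [Nat.succ_mul_centralBinom_succ]; ring
      _ ≤ 16 ^ h * (4 * (4 * (h + 1) ^ 2)) := Nat.mul_le_mul ih (by nlinarith)
      _ = (h + 1) ^ 2 * 16 ^ (h + 1) := by ring

theorem tendsto_centralBinom_div_four_pow :
    Tendsto (fun h : ℕ => (h.centralBinom : ℝ) / 4 ^ h) atTop (nhds 0) := by
  have hbound (h : ℕ) : (h.centralBinom : ℝ) / 4 ^ h ≤ √(1 / ((h : ℝ) + 1)) := by
    refine Real.le_sqrt_of_sq_le ?_
    have hsq : (h.centralBinom : ℝ) ^ 2 * (2 * h + 1) ≤ 16 ^ h := by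
      exact_mod_cast centralBinom_sq_mul_le h
    rw [div_pow, ← pow_mul, mul_comm h, pow_mul, div_le_div_iff₀ (by positivity) (by positivity)]
    norm_num
    exact (by gcongr; linarith : (h.centralBinom : ℝ) ^ 2 * (h + 1) ≤ _).trans hsq
  refine squeeze_zero (fun h => by positivity) hbound ?_
  simpa using tendsto_one_div_add_atTop_nhds_zero_nat.sqrt

theorem exp_neg_two_mul_le_one_sub {x : ℝ} (h0 : 0 ≤ x) (h1 : x ≤ 1 / 2) :
    Real.exp (-(2 * x)) ≤ 1 - x := by
  have h := Real.add_one_le_exp (2 * x)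
  rw [Real.exp_neg, inv_le_comm₀ (Real.exp_pos _) (by linarith)]
  refine le_trans ?_ h
  rw [inv_le_iff_one_le_mul₀ (by linarith)]
  nlinarith

theorem pow_mul_exp_neg_le_prod_sub {V : Type*} [Fintype V] {N : ℕ} (a : V → ℕ)
    (ha : ∀ v, 2 * a v ≤ N) :
    (N : ℝ) ^ Fintype.card V * Real.exp (-(2 * (∑ v, a v : ℕ) / N)) ≤
      (∏ v, (N - a v) : ℕ) := by
  have hfactor (v : V) : (N : ℝ) * Real.exp (-(2 * (a v / N))) ≤ (N - a v : ℕ) := by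
    obtain rfl | hN := N.eq_zero_or_pos
    · simp
    have h2a : (2 * a v : ℝ) ≤ N := by exact_mod_cast ha v
    rw [Nat.cast_sub (by linarith [ha v])]
    calc (N : ℝ) * Real.exp (-(2 * (a v / N))) ≤ N * (1 - a v / N) := by
          gcongr
          refine exp_neg_two_mul_le_one_sub (by positivity) ?_
          rw [div_le_iff₀ (by positivity)]; linarith
      _ = N - a v := by field_simp
  calc (N : ℝ) ^ Fintype.card V * Real.exp (-(2 * (∑ v, a v : ℕ) / N))
      = ∏ v, (N : ℝ) * Real.exp (-(2 * (a v / N))) := by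
        rw [prod_mul_distrib, prod_const, card_univ, ← Real.exp_sum, sum_neg_distrib, ← mul_sum,
          ← sum_div, Nat.cast_sum, mul_div_assoc]
    _ ≤ ∏ v, ((N - a v : ℕ) : ℝ) := prod_le_prod (fun v _ => by positivity) fun v _ => hfactor v
    _ = (∏ v, (N - a v) : ℕ) := by push_cast; rfl

theorem exists_injOn_powerset_sum {V : Type*} (X : Finset V) :
    ∃ w : V → ℕ, (∀ x, 0 < w x ∧ w x ≤ 2 ^ #X) ∧
      Set.InjOn (fun A => ∑ x ∈ A, w x) (X.powerset : Set (Finset V)) := by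
  classical
  set index : V → ℕ := fun x => X.toList.idxOf x
  have hindex : Set.InjOn index X := fun x hx y _ h => (List.idxOf_inj (by simpa using hx)).1 h
  refine ⟨fun x => 2 ^ index x, fun x => ⟨by positivity, ?_⟩, fun A hA B hB h => ?_⟩
  · have hle : index x ≤ #X := by simpa using List.idxOf_le_length (l := X.toList) (a := x)
    exact Nat.pow_le_pow_right two_pos hle
  · refine image_injOn_powerset_of_injOn hindex hA hB (geomSum_injective le_rfl ?_)
    simp only [coe_powerset, Set.mem_preimage, Set.mem_powerset_iff] at hA hB
    simpa only [sum_image (hindex.mono hA), sum_image (hindex.mono hB)] using h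

section LinearEquations

variable {V : Type*} [Fintype V]

theorem sum_mul_sub_sum_mul_of_forall_ne {R : Type*} [CommRing R] {x₀ : V} {z z' : V → R}
    (h : ∀ x ≠ x₀, z x = z' x) (c : V → R) :
    ∑ x, c x * z x - ∑ x, c x * z' x = c x₀ * (z x₀ - z' x₀) := by
  rw [← sum_sub_distrib, Fintype.sum_eq_single x₀ fun x hx => by rw [h x hx, sub_self]]
  ring

variable [DecidableEq V]

/-- The solutions of the linear equation `∑ x, c x * g x = t` in the box `{0, …, N - 1} ^ V`. -/
def boxSolutions (c : V → ℤ) (t : ℤ) (N : ℕ) : Finset (V → Fin N) :=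
  {g | ∑ x, c x * (g x : ℕ) = t}

theorem mem_boxSolutions {c : V → ℤ} {t : ℤ} {N : ℕ} {g : V → Fin N} :
    g ∈ boxSolutions c t N ↔ ∑ x, c x * ((g x : ℕ) : ℤ) = t := by
  simp [boxSolutions]

theorem eq_of_mem_boxSolutions {c : V → ℤ} {t : ℤ} {N : ℕ} {x₀ : V} (hc : c x₀ ≠ 0)
    {g g' : V → Fin N} (hg : g ∈ boxSolutions c t N) (hg' : g' ∈ boxSolutions c t N)
    (h : ∀ x ≠ x₀, g x = g' x) : g x₀ = g' x₀ := by
  have hsub := sum_mul_sub_sum_mul_of_forall_ne (z := fun x => ((g x : ℕ) : ℤ))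
    (z' := fun x => ((g' x : ℕ) : ℤ)) (fun x hx => by rw [h x hx]) c
  rw [mem_boxSolutions.1 hg, mem_boxSolutions.1 hg', sub_self, zero_eq_mul] at hsub
  exact Fin.ext (by have := hsub.resolve_left hc; omega)

theorem card_boxSolutions_mul_le {c : V → ℤ} {x₀ : V} (hc : c x₀ ≠ 0) (t : ℤ) (N : ℕ) :
    #(boxSolutions c t N) * N ≤ N ^ Fintype.card V := by
  have h := card_mul_pow_le_of_card_fiber_le (boxSolutions c t N) {x₀} (K := 1) fun g₀ => by
    refine card_le_one.2 fun g hg g' hg' => ?_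
    simp only [mem_filter, mem_singleton] at hg hg'
    have hoff (x) (hx : x ≠ x₀) : g x = g' x := (hg.2 x hx).trans (hg'.2 x hx).symm
    have hx₀ := eq_of_mem_boxSolutions hc hg.1 hg'.1 hoff
    exact funext fun x => (eq_or_ne x x₀).elim (fun hx => hx ▸ hx₀) (hoff x)
  simpa using h

theorem card_filter_dvd_sub_mul_le {c : V → ℤ} {x₀ : V} {M : ℕ} (hc : IsCoprime (M : ℤ) (c x₀))
    (t : ℤ) :
    #{y : V → Fin M | (M : ℤ) ∣ ∑ x, c x * (y x : ℕ) - t} * M ≤ M ^ Fintype.card V := by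
  have h := card_mul_pow_le_of_card_fiber_le
    {y : V → Fin M | (M : ℤ) ∣ ∑ x, c x * (y x : ℕ) - t} {x₀} (K := 1) fun y₀ => by
    refine card_le_one.2 fun y hy y' hy' => ?_
    simp only [mem_filter, mem_univ, true_and, mem_singleton] at hy hy'
    have hoff (x) (hx : x ≠ x₀) : y x = y' x := (hy.2 x hx).trans (hy'.2 x hx).symm
    have hsub := sum_mul_sub_sum_mul_of_forall_ne (z := fun x => ((y x : ℕ) : ℤ))
      (z' := fun x => ((y' x : ℕ) : ℤ)) (fun x hx => by rw [hoff x hx]) c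
    have hdvd : (M : ℤ) ∣ ((y x₀ : ℕ) : ℤ) - (y' x₀ : ℕ) := by
      refine hc.dvd_of_dvd_mul_left ?_
      simpa [← hsub] using dvd_sub hy.1 hy'.1
    have hx₀ : y x₀ = y' x₀ := by
      have := Int.eq_zero_of_abs_lt_dvd hdvd (by rw [abs_lt]; omega)
      exact Fin.ext (by omega)
    exact funext fun x => (eq_or_ne x x₀).elim (fun hx => hx ▸ hx₀) (hoff x)
  simpa using h

theorem card_boxSolutions_two_mul_pow_le (c : V → ℤ) (s : ℤ) {T : Finset V}
    (hc : ∀ x ∈ T, c x ≠ 0) :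
    #(boxSolutions c s 2) * 2 ^ #T ≤ (#T).choose (#T / 2) * 2 ^ Fintype.card V := by
  have h := card_mul_pow_le_of_card_fiber_le (boxSolutions c s 2) T
    (K := (#T).choose (#T / 2)) fun g₀ => by
    have hchoose := card_filter_sum_eq_le_choose (c := fun x : T => c x) (fun x => hc x x.2)
      (s - ∑ x ∈ Tᶜ, c x * (g₀ x : ℕ))
    rw [Fintype.card_coe] at hchoose
    refine (card_le_card_of_injOn (fun g => ({x : T | g x = 1} : Finset T)) ?_ ?_).trans hchoose
    · intro g hg
      simp only [coe_filter, Set.mem_ofPred_eq, mem_boxSolutions, mem_univ, true_and] at hg ⊢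
      have hT : ∑ x ∈ T, c x * ((g x : ℕ) : ℤ) = ∑ x ∈ ({x | g x = 1} : Finset T), c x := by
        rw [sum_filter, ← sum_coe_sort T]
        refine sum_congr rfl fun x _ => ?_
        obtain h | h : g x = 0 ∨ g x = 1 := by omega
        all_goals simp [h]
      have hTc : ∑ x ∈ Tᶜ, c x * ((g x : ℕ) : ℤ) = ∑ x ∈ Tᶜ, c x * (g₀ x : ℕ) :=
        sum_congr rfl fun x hx => by rw [hg.2 x (mem_compl.1 hx)]
      rw [← hT, ← hTc, ← hg.1, ← sum_add_sum_compl T, add_sub_cancel_right]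
    · intro g hg g' hg' h
      simp only [coe_filter, Set.mem_ofPred_eq] at hg hg'
      funext x
      by_cases hx : x ∈ T
      · have hiff := Finset.ext_iff.1 h ⟨x, hx⟩
        simp only [mem_filter, mem_univ, true_and] at hiff
        omega
      · rw [hg.2 x hx, hg'.2 x hx]
  simpa using h

theorem card_boxSolutions_two_mul_le {c : V → ℤ} {x₀ : V} {M : ℕ}
    (hM : IsCoprime (M : ℤ) (c x₀)) (hM0 : 0 < M) (t : ℤ) {T : Finset V}
    (hc : ∀ x ∈ T, c x ≠ 0) :
    #(boxSolutions c t (2 * M)) * (M * 2 ^ #T) ≤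
      (#T).choose (#T / 2) * (2 * M) ^ Fintype.card V := by
  let Y : Finset (V → Fin M) := {y | (M : ℤ) ∣ ∑ x, c x * (y x : ℕ) - t}
  let high : (V → Fin (2 * M)) → V → Fin 2 := fun g x => (g x).divNat
  let low : (V → Fin (2 * M)) → V → Fin M := fun g x => (g x).modNat
  have hsplit (g : V → Fin (2 * M)) : ∑ x, c x * ((g x : ℕ) : ℤ) =
      ∑ x, c x * ((low g x : ℕ) : ℤ) + M * ∑ x, c x * ((high g x : ℕ) : ℤ) := by
    rw [mul_sum, ← sum_add_distrib]
    refine sum_congr rfl fun x _ => ?_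
    rw [show ((g x : ℕ) : ℤ) = (low g x : ℕ) + M * (high g x : ℕ) by
      exact_mod_cast (Nat.mod_add_div _ _).symm]
    ring
  have hlow : ∀ g ∈ boxSolutions c t (2 * M), low g ∈ Y := fun g hg => by
    rw [mem_boxSolutions, hsplit] at hg
    simp only [Y, mem_filter, mem_univ, true_and]
    exact ⟨-∑ x, c x * ((high g x : ℕ) : ℤ), by linarith⟩
  have hfiber (y) : #{g ∈ boxSolutions c t (2 * M) | low g = y} * 2 ^ #T ≤
      (#T).choose (#T / 2) * 2 ^ Fintype.card V := by
    refine le_trans (Nat.mul_le_mul_right _ ?_) (card_boxSolutions_two_mul_pow_le c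
      ((t - ∑ x, c x * (y x : ℕ)) / M) hc)
    refine card_le_card_of_injOn high (fun g hg => ?_) fun g hg g' hg' h => ?_
    · simp only [coe_filter, Set.mem_ofPred_eq, mem_boxSolutions] at hg
      rw [mem_coe, mem_boxSolutions, ← hg.1, hsplit, hg.2, add_sub_cancel_left,
        Int.mul_ediv_cancel_left _ (by omega)]
    · simp only [coe_filter, Set.mem_ofPred_eq] at hg hg'
      exact funext fun x => finProdFinEquiv.symm.injective <|
        Prod.ext (congrFun h x) (congrFun (hg.2.trans hg'.2.symm) x)
  calc #(boxSolutions c t (2 * M)) * (M * 2 ^ #T)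
      = (∑ y ∈ Y, #{g ∈ boxSolutions c t (2 * M) | low g = y} * 2 ^ #T) * M := by
        rw [card_eq_sum_card_fiberwise hlow, ← sum_mul]; ring
    _ ≤ (∑ _y ∈ Y, (#T).choose (#T / 2) * 2 ^ Fintype.card V) * M :=
        Nat.mul_le_mul_right _ (sum_le_sum fun y _ => hfiber y)
    _ = (#T).choose (#T / 2) * 2 ^ Fintype.card V * (#Y * M) := by
        rw [sum_const, smul_eq_mul]; ring
    _ ≤ (#T).choose (#T / 2) * 2 ^ Fintype.card V * M ^ Fintype.card V :=
        Nat.mul_le_mul_left _ (card_filter_dvd_sub_mul_le hM t)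
    _ = (#T).choose (#T / 2) * (2 * M) ^ Fintype.card V := by rw [mul_pow]; ring

theorem cast_card_biUnion_le {α β : Type*} [DecidableEq β] {s : Finset α} {f : α → Finset β}
    {b : ℝ} (h : ∀ a ∈ s, (#(f a) : ℝ) ≤ b) : (#(s.biUnion f) : ℝ) ≤ #s * b := by
  calc (#(s.biUnion f) : ℝ) ≤ ∑ a ∈ s, (#(f a) : ℝ) := by exact_mod_cast card_biUnion_le
    _ ≤ #s * b := by simpa using sum_le_card_nsmul _ _ _ h

open Classical in
theorem sum_card_filter_isGreatest_le {α κ : Type*} [Fintype α] [PartialOrder α]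
    (P : Finset κ) (s : κ → Set α) : ∑ v, #{p ∈ P | IsGreatest (s p) v} ≤ #P := by
  rw [← card_biUnion fun v _ v' _ hne => disjoint_filter.2 fun p _ h h' => hne (h.unique h')]
  exact card_le_card (biUnion_subset.2 fun v _ => filter_subset _ _)

open Classical in
-- Each equation is charged to its last variable, whose value it determines from the earlier ones.
theorem prod_sub_le_card_forall_notMem_boxSolutions {V κ : Type*} [Fintype V] [LinearOrder V]
    {N : ℕ} (hN : 0 < N) {P : Finset κ} {c : κ → V → ℤ} (hc : ∀ p ∈ P, c p ≠ 0) (t : κ → ℤ) :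
    ∏ v, (N - #{p ∈ P | IsGreatest (Function.support (c p)) v}) ≤
      #{g : V → Fin N | ∀ p ∈ P, g ∉ boxSolutions (c p) (t p) N} := by
  have : Nonempty (Fin N) := ⟨⟨0, hN⟩⟩
  let P' : V → Finset κ := fun v => {p ∈ P | IsGreatest (Function.support (c p)) v}
  let forbidden : V → (V → Fin N) → Finset (Fin N) := fun v g =>
    (P' v).biUnion fun p => {b | Function.update g v b ∈ boxSolutions (c p) (t p) N}
  have hearlier (v : V) (g g' : V → Fin N) (h : ∀ u < v, g u = g' u) :
      forbidden v g = forbidden v g' := by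
    refine biUnion_congr rfl fun p hp => filter_congr fun b _ => ?_
    have hlast : IsGreatest (Function.support (c p)) v := (mem_filter.1 hp).2
    rw [mem_boxSolutions, mem_boxSolutions]
    refine Eq.congr_left (sum_congr rfl fun x _ => ?_)
    obtain hx | rfl | hx := lt_trichotomy x v
    · rw [Function.update_of_ne hx.ne, Function.update_of_ne hx.ne, h x hx]
    · rw [Function.update_self, Function.update_self]
    · have hcx : c p x = 0 := by
        by_contra hcx
        exact hx.not_ge (hlast.2 hcx)
      rw [hcx, zero_mul, zero_mul]
  have hcard (v : V) (g : V → Fin N) : #(forbidden v g) ≤ #(P' v) := by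
    refine (card_biUnion_le_card_mul _ _ 1 fun p hp => ?_).trans (mul_one _).le
    refine card_le_one.2 fun b hb b' hb' => ?_
    have hlast : IsGreatest (Function.support (c p)) v := (mem_filter.1 hp).2
    simpa using eq_of_mem_boxSolutions hlast.1 (mem_filter.1 hb).2 (mem_filter.1 hb').2
      fun x hx => by rw [Function.update_of_ne hx, Function.update_of_ne hx]
  have hprod := prod_sub_le_card_forall_notMem forbidden (fun v => #(P' v)) hearlier hcard
  rw [Fintype.card_fin] at hprod
  refine hprod.trans (card_le_card fun g hg => ?_)
  simp only [mem_filter, mem_univ, true_and] at hg ⊢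
  intro p hp hsol
  obtain ⟨v, hv, hmax⟩ := Set.exists_max_image _ id (Set.toFinite (Function.support (c p)))
    (Function.support_nonempty_iff.2 (hc p hp))
  refine hg v (mem_biUnion.2 ⟨p, mem_filter.2 ⟨hp, hv, hmax⟩, ?_⟩)
  simpa using hsol

theorem pow_mul_exp_neg_le_card_forall_notMem_boxSolutions {κ : Type*} {N : ℕ} (hN : 0 < N)
    {P : Finset κ} {c : κ → V → ℤ} (hc : ∀ p ∈ P, c p ≠ 0)
    (hP : ∀ v, 2 * #{p ∈ P | c p v ≠ 0} ≤ N) (t : κ → ℤ) :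
    (N : ℝ) ^ Fintype.card V * Real.exp (-(2 * #P / N)) ≤
      #{g : V → Fin N | ∀ p ∈ P, g ∉ boxSolutions (c p) (t p) N} := by
  classical
  let e := Fintype.equivFin V
  let _ : LinearOrder V := LinearOrder.lift' e e.injective
  let last : V → Finset κ := fun v => {p ∈ P | IsGreatest (Function.support (c p)) v}
  have hlastsub (v : V) : last v ⊆ {p ∈ P | c p v ≠ 0} := fun p hp => by
    obtain ⟨hp, hv⟩ := mem_filter.1 hp
    exact mem_filter.2 ⟨hp, hv.1⟩
  have hlast (v : V) : 2 * #(last v) ≤ N :=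
    (Nat.mul_le_mul_left 2 (card_le_card (hlastsub v))).trans (hP v)
  have hsum : ∑ v, #(last v) ≤ #P := sum_card_filter_isGreatest_le P _
  calc (N : ℝ) ^ Fintype.card V * Real.exp (-(2 * #P / N))
      ≤ (N : ℝ) ^ Fintype.card V * Real.exp (-(2 * (∑ v, #(last v) : ℕ) / N)) := by gcongr
    _ ≤ (∏ v, (N - #(last v)) : ℕ) := pow_mul_exp_neg_le_prod_sub _ hlast
    _ ≤ _ := by
      rw [Nat.cast_le]
      convert prod_sub_le_card_forall_notMem_boxSolutions hN hc t

-- Union bound: `S` is handled by the sequential count, and the solutions of the equations in `R`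
-- and `L` are then removed from what remains.
theorem exists_forall_notMem_boxSolutions {κ : Type*} {M D : ℕ} (hM : 0 < M) (hD : 0 < D)
    {S R L : Finset κ} {c : κ → V → ℤ} (hS : ∀ p ∈ S, c p ≠ 0)
    (hSM : ∀ v, #{p ∈ S | c p v ≠ 0} ≤ M) (hR : ∀ p ∈ R, c p ≠ 0)
    (hL : ∀ p ∈ L, ∃ T : Finset V, #T = D ∧ ∀ x ∈ T, IsUnit (c p x))
    (h : (#R / (2 * M) + #L * (D.choose (D / 2) / (M * 2 ^ D)) : ℝ) < Real.exp (-(#S / M)))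
    (t : κ → ℤ) :
    ∃ g : V → Fin (2 * M), ∀ p, p ∈ S ∨ p ∈ R ∨ p ∈ L →
      g ∉ boxSolutions (c p) (t p) (2 * M) := by
  classical
  have hN : (0 : ℝ) < (2 * M : ℕ) ^ Fintype.card V := by positivity
  set good : Finset (V → Fin (2 * M)) := {g | ∀ p ∈ S, g ∉ boxSolutions (c p) (t p) (2 * M)}
  have hgood : ((2 * M : ℕ) : ℝ) ^ Fintype.card V * Real.exp (-(#S / M)) ≤ #good := by
    have hexp : (2 * #S / (2 * M : ℕ) : ℝ) = #S / M := by push_cast; field_simp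
    simpa only [hexp] using pow_mul_exp_neg_le_card_forall_notMem_boxSolutions
      (show 0 < 2 * M by lia) hS (fun v => Nat.mul_le_mul_left 2 (hSM v)) t
  have hRsol (p) (hp : p ∈ R) : (#(boxSolutions (c p) (t p) (2 * M)) : ℝ) ≤
      (2 * M : ℕ) ^ Fintype.card V * (1 / (2 * M)) := by
    obtain ⟨x, hx⟩ := Function.ne_iff.1 (hR p hp)
    rw [mul_one_div, le_div_iff₀ (by positivity)]
    exact_mod_cast card_boxSolutions_mul_le hx (t p) (2 * M)
  have hLsol (p) (hp : p ∈ L) : (#(boxSolutions (c p) (t p) (2 * M)) : ℝ) ≤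
      (2 * M : ℕ) ^ Fintype.card V * (D.choose (D / 2) / (M * 2 ^ D)) := by
    obtain ⟨T, rfl, hT⟩ := hL p hp
    obtain ⟨x, hx⟩ := card_pos.1 hD
    have hcop : IsCoprime (M : ℤ) (c p x) :=
      isCoprime_one_right.of_isCoprime_of_dvd_right (hT x hx).dvd
    rw [mul_div_assoc', le_div_iff₀ (by positivity), mul_comm ((_ : ℝ) ^ _)]
    exact_mod_cast card_boxSolutions_two_mul_le hcop hM (t p)
      fun y hy => (hT y hy).ne_zero
  have hbad : (#(R.biUnion fun p => boxSolutions (c p) (t p) (2 * M)) : ℝ) +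
      #(L.biUnion fun p => boxSolutions (c p) (t p) (2 * M)) < #good := by
    refine (add_le_add (cast_card_biUnion_le hRsol) (cast_card_biUnion_le hLsol)).trans_lt ?_
    refine lt_of_lt_of_le ?_ hgood
    calc _ = ((2 * M : ℕ) : ℝ) ^ Fintype.card V *
          (#R / (2 * M) + #L * (D.choose (D / 2) / (M * 2 ^ D))) := by ring
      _ < _ := mul_lt_mul_of_pos_left h hN
  obtain ⟨g, hg, hgbad⟩ := exists_mem_notMem_of_card_lt_card
    (lt_of_le_of_lt (card_union_le _ _) (by exact_mod_cast hbad))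
  simp only [mem_union, mem_biUnion, not_or, not_exists, not_and] at hgbad
  refine ⟨g, ?_⟩
  rintro p (hp | hp | hp)
  exacts [(mem_filter.1 hg).2 p hp, hgbad.1 p hp, hgbad.2 p hp]

end LinearEquations

section SetFamilies

variable {V ι : Type*} [DecidableEq V]

/-- The difference of the indicator functions of `A` and `B`, as a vector of coefficients. -/
def indicatorDiff (A B : Finset V) (x : V) : ℤ :=
  (if x ∈ A then 1 else 0) - (if x ∈ B then 1 else 0)

theorem indicatorDiff_ne_zero_iff {A B : Finset V} {x : V} :
    indicatorDiff A B x ≠ 0 ↔ x ∈ A ∆ B := by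
  by_cases hA : x ∈ A <;> by_cases hB : x ∈ B <;> simp [indicatorDiff, mem_symmDiff, hA, hB]

theorem isUnit_indicatorDiff {A B : Finset V} {x : V} (hx : x ∈ A ∆ B) :
    IsUnit (indicatorDiff A B x) := by
  obtain ⟨hA, hB⟩ | ⟨hB, hA⟩ := mem_symmDiff.1 hx <;> simp [indicatorDiff, hA, hB]

theorem indicatorDiff_ne_zero {A B : Finset V} (h : A ≠ B) : indicatorDiff A B ≠ 0 := by
  obtain ⟨x, hx⟩ := symmDiff_nonempty.2 h
  exact Function.ne_iff.2 ⟨x, indicatorDiff_ne_zero_iff.2 hx⟩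

theorem sum_indicatorDiff_mul [Fintype V] (A B : Finset V) (f : V → ℤ) :
    ∑ x, indicatorDiff A B x * f x = ∑ x ∈ A, f x - ∑ x ∈ B, f x := by
  simp [indicatorDiff, sub_mul]

variable [Fintype ι] (E : ι → Finset V)

open Classical in
/-- The pairs of members of the family `E` whose symmetric difference has its size in `I`. -/
noncomputable def pairsAtDist (I : Set ℕ) : Finset (ι × ι) :=
  {p | #(E p.1 ∆ E p.2) ∈ I}

variable {E} in
theorem mem_pairsAtDist {I : Set ℕ} {p : ι × ι} :
    p ∈ pairsAtDist E I ↔ #(E p.1 ∆ E p.2) ∈ I := by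
  simp [pairsAtDist]

theorem card_finset_prod_self_le (P : Finset (ι × ι)) : #P ≤ Fintype.card ι ^ 2 := by
  simpa [sq] using card_le_univ P

theorem exists_mul_card_pairsAtDist_Ioc_le {D : ℕ → ℕ} (hD : Monotone D) {T : ℕ} (hT : 0 < T) :
    ∃ i < T, T * #(pairsAtDist E (Set.Ioc (D i) (D (i + 1)))) ≤ Fintype.card ι ^ 2 := by
  classical
  have hdisjoint (i j : ℕ) (hij : i ≠ j) : Disjoint (pairsAtDist E (Set.Ioc (D i) (D (i + 1))))
      (pairsAtDist E (Set.Ioc (D j) (D (j + 1)))) :=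
    Finset.disjoint_left.2 fun p hp hp' => Set.disjoint_left.1
      (hD.pairwise_disjoint_on_Ioc_succ hij) (mem_pairsAtDist.1 hp) (mem_pairsAtDist.1 hp')
  have hsum : ∑ i ∈ range T, #(pairsAtDist E (Set.Ioc (D i) (D (i + 1)))) ≤
      Fintype.card ι ^ 2 := by
    rw [← card_biUnion fun i _ j _ hij => hdisjoint i j hij]
    exact card_finset_prod_self_le _
  simpa using exists_le_of_sum_le (f := fun i => T * #(pairsAtDist E (Set.Ioc (D i) (D (i + 1)))))
    (g := fun _ => Fintype.card ι ^ 2) (nonempty_range_iff.2 hT.ne')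
    (by simpa [← mul_sum] using Nat.mul_le_mul_left T hsum)

theorem sdiff_symmDiff_sdiff (A B X : Finset V) : (A \ X) ∆ (B \ X) = (A ∆ B) \ X := by
  ext x; simp only [mem_symmDiff, Finset.mem_sdiff]; tauto

variable [Fintype V]

/-- The elements separating more than `M` of the pairs of members of `E` at distance at most `D`;
their labels are fixed separately, so that every other element occurs in few of the equations that
come from such pairs. -/
noncomputable def heavyElements (D M : ℕ) : Finset V :=
  {x | M < #{p ∈ pairsAtDist E (Set.Iic D) | x ∈ E p.1 ∆ E p.2}}

theorem card_heavyElements_mul_le (D M : ℕ) :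
    #(heavyElements E D M) * M ≤ Fintype.card ι ^ 2 * D := by
  let separates : V → ι × ι → Prop := fun x p => x ∈ E p.1 ∆ E p.2
  have hheavy (x) (hx : x ∈ heavyElements E D M) :
      M ≤ #((pairsAtDist E (Set.Iic D)).bipartiteAbove separates x) := (mem_filter.1 hx).2.le
  have hclose (p) (hp : p ∈ pairsAtDist E (Set.Iic D)) :
      #((heavyElements E D M).bipartiteBelow separates p) ≤ D := by
    refine (card_le_card ?_).trans (mem_pairsAtDist.1 hp)
    exact fun x hx => (mem_bipartiteBelow separates).1 hx |>.2
  calc #(heavyElements E D M) * M ≤ #(pairsAtDist E (Set.Iic D)) * D :=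
        card_mul_le_card_mul separates hheavy hclose
    _ ≤ Fintype.card ι ^ 2 * D := Nat.mul_le_mul_right _ (card_finset_prod_self_le _)

variable {E}

theorem card_filter_mem_symmDiff_le {D M : ℕ} {x : V} (hx : x ∉ heavyElements E D M) :
    #{p ∈ pairsAtDist E (Set.Iic D) | x ∈ E p.1 ∆ E p.2} ≤ M :=
  not_lt.1 fun h => hx (mem_filter.2 ⟨mem_univ x, h⟩)

theorem card_heavyElements_le {C M : ℕ} (hM : 0 < M) (hCM : Fintype.card ι ^ 2 ≤ C * M) (D : ℕ) :
    #(heavyElements E D M) ≤ C * D := by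
  refine Nat.le_of_mul_le_mul_right ?_ hM
  calc #(heavyElements E D M) * M ≤ Fintype.card ι ^ 2 * D := card_heavyElements_mul_le E D M
    _ ≤ C * M * D := Nat.mul_le_mul_right _ hCM
    _ = C * D * M := by ring

theorem exists_isUnit_indicatorDiff_sdiff_heavyElements {C D M : ℕ} (hM : 0 < M)
    (hCM : Fintype.card ι ^ 2 ≤ C * M) {p : ι × ι}
    (hp : p ∈ pairsAtDist E (Set.Ioi ((C + 1) * D))) :
    ∃ U : Finset V, #U = D ∧ ∀ x ∈ U,
      IsUnit (indicatorDiff (E p.1 \ heavyElements E D M) (E p.2 \ heavyElements E D M) x) := by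
  have hcard : D ≤ #((E p.1 ∆ E p.2) \ heavyElements E D M) := by
    have hfar : (C + 1) * D < #(E p.1 ∆ E p.2) := mem_pairsAtDist.1 hp
    have hheavy := card_heavyElements_le (E := E) hM hCM D
    have hsdiff := le_card_sdiff (heavyElements E D M) (E p.1 ∆ E p.2)
    lia
  obtain ⟨U, hU, hUD⟩ := exists_subset_card_eq hcard
  refine ⟨U, hUD, fun x hx => isUnit_indicatorDiff ?_⟩
  rw [sdiff_symmDiff_sdiff]
  exact hU hx

theorem div_add_mul_lt_exp_neg {C T M S R L b q : ℝ} (hM : 0 < M) (hT : 0 < T) (hb : 0 ≤ b)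
    (hq : 0 < q) (hS : S ≤ C * M) (hR : T * R ≤ C * M) (hL : L ≤ C * M)
    (h : C / (2 * T) + C * (b / q) < Real.exp (-C)) :
    R / (2 * M) + L * (b / (M * q)) < Real.exp (-(S / M)) := by
  have hRM : R / (2 * M) ≤ C / (2 * T) := by
    rw [div_le_div_iff₀ (by positivity) (by positivity)]; linarith
  calc R / (2 * M) + L * (b / (M * q))
      ≤ C / (2 * T) + C * M * (b / (M * q)) :=
        add_le_add hRM (mul_le_mul_of_nonneg_right hL (by positivity))
    _ = C / (2 * T) + C * (b / q) := by field_simp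
    _ < Real.exp (-C) := h
    _ ≤ Real.exp (-(S / M)) := by gcongr; rwa [div_le_iff₀ hM]

-- Pairs at distance at most `D` give sparse equations, pairs at distance in `(D, (C + 1) D]` are
-- few, and equations from pairs further apart keep `D` variables outside the heavy elements.
theorem exists_add_sum_sdiff_heavyElements_ne {C D T M : ℕ} (hM : 0 < M) (hD : 0 < D) (hT : 0 < T)
    (hCM : Fintype.card ι ^ 2 ≤ C * M)
    (hmid : T * #(pairsAtDist E (Set.Ioc D ((C + 1) * D))) ≤ Fintype.card ι ^ 2)
    (hconst : (C / (2 * T) + C * (D.choose (D / 2) / 2 ^ D) : ℝ) < Real.exp (-C)) (a : ι → ℤ) :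
    ∃ g : V → Fin (2 * M), ∀ u v,
      E u \ heavyElements E D M ≠ E v \ heavyElements E D M →
        a u + ∑ x ∈ E u \ heavyElements E D M, ((g x : ℕ) : ℤ) ≠
          a v + ∑ x ∈ E v \ heavyElements E D M, ((g x : ℕ) : ℤ) := by
  classical
  set X := heavyElements E D M
  let c : ι × ι → V → ℤ := fun p => indicatorDiff (E p.1 \ X) (E p.2 \ X)
  let near : Finset (ι × ι) := {p ∈ pairsAtDist E (Set.Iic D) | c p ≠ 0}
  let middle : Finset (ι × ι) := {p ∈ pairsAtDist E (Set.Ioc D ((C + 1) * D)) | c p ≠ 0}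
  let far : Finset (ι × ι) := pairsAtDist E (Set.Ioi ((C + 1) * D))
  have hnear (x : V) : #{p ∈ near | c p x ≠ 0} ≤ M := by
    by_cases hx : x ∈ X
    · simp [c, indicatorDiff, hx]
    · refine (card_le_card fun p hp => ?_).trans (card_filter_mem_symmDiff_le hx)
      obtain ⟨hp, hpx⟩ := mem_filter.1 hp
      rw [indicatorDiff_ne_zero_iff, sdiff_symmDiff_sdiff] at hpx
      exact mem_filter.2 ⟨(mem_filter.1 hp).1, (Finset.mem_sdiff.1 hpx).1⟩
  have hcard (P : Finset (ι × ι)) : (#P : ℝ) ≤ C * M := by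
    exact_mod_cast (card_finset_prod_self_le P).trans hCM
  have hmiddle : (T * #middle : ℝ) ≤ C * M := by
    exact_mod_cast ((Nat.mul_le_mul_left T (card_le_card (filter_subset _ _))).trans hmid).trans hCM
  have hbound := div_add_mul_lt_exp_neg (by positivity) (by positivity) (by positivity)
    (by positivity) (hcard near) hmiddle (hcard far) hconst
  obtain ⟨g, hg⟩ := exists_forall_notMem_boxSolutions hM hD (fun p hp => (mem_filter.1 hp).2) hnear
    (fun p hp => (mem_filter.1 hp).2)
    (fun p hp => exists_isUnit_indicatorDiff_sdiff_heavyElements hM hCM hp) hbound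
    fun p => a p.2 - a p.1
  refine ⟨g, fun u v huv heq => hg (u, v) ?_ ?_⟩
  · have hc : c (u, v) ≠ 0 := indicatorDiff_ne_zero huv
    obtain h | h := le_or_gt #(E u ∆ E v) D
    · exact .inl (mem_filter.2 ⟨mem_pairsAtDist.2 h, hc⟩)
    obtain h' | h' := le_or_gt #(E u ∆ E v) ((C + 1) * D)
    · exact .inr (.inl (mem_filter.2 ⟨mem_pairsAtDist.2 ⟨h, h'⟩, hc⟩))
    · exact .inr (.inr (mem_pairsAtDist.2 h'))
  · rw [mem_boxSolutions, sum_indicatorDiff_mul]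
    linarith

end SetFamilies

theorem exists_labeling_sum_ne {V ι : Type*} [Finite V] [DecidableEq V] [Fintype ι]
    {E : ι → Finset V} {C D T M : ℕ} (hM : 0 < M) (hD : 0 < D) (hT : 0 < T)
    (hCM : Fintype.card ι ^ 2 ≤ C * M) (hpow : 2 ^ (C * D) ≤ 2 * M)
    (hmid : T * #(pairsAtDist E (Set.Ioc D ((C + 1) * D))) ≤ Fintype.card ι ^ 2)
    (hconst : (C / (2 * T) + C * (D.choose (D / 2) / 2 ^ D) : ℝ) < Real.exp (-C)) :
    ∃ f : V → ℕ, (∀ x, 0 < f x ∧ f x ≤ 2 * M) ∧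
      ∀ u v, E u ≠ E v → ∑ x ∈ E u, f x ≠ ∑ x ∈ E v, f x := by
  cases nonempty_fintype V
  set X := heavyElements E D M with hX
  obtain ⟨w, hw, hinj⟩ := exists_injOn_powerset_sum X
  obtain ⟨g, hg⟩ := exists_add_sum_sdiff_heavyElements_ne hM hD hT hCM hmid hconst
    fun u => ∑ x ∈ E u ∩ X, (w x : ℤ) + #(E u \ X)
  rw [← hX] at hg
  refine ⟨X.piecewise w fun x => g x + 1, fun x => ?_, fun u v huv => ?_⟩
  · by_cases hx : x ∈ X
    · rw [piecewise_eq_of_mem _ _ _ hx]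
      exact ⟨(hw x).1, (hw x).2.trans ((Nat.pow_le_pow_right two_pos
        (card_heavyElements_le hM hCM D)).trans hpow)⟩
    · rw [piecewise_eq_of_notMem _ _ _ hx]
      lia
  · have hsum (A : Finset V) : ∑ x ∈ A, X.piecewise w (fun x => g x + 1) x =
        ∑ x ∈ A ∩ X, w x + #(A \ X) + ∑ x ∈ A \ X, (g x : ℕ) := by
      rw [sum_piecewise, sum_add_distrib, sum_const, smul_eq_mul, mul_one]
      ring
    rw [hsum, hsum]
    by_cases hout : E u \ X = E v \ X
    · rw [hout, Ne, Nat.add_right_cancel_iff, Nat.add_right_cancel_iff]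
      intro hin
      have hinter := hinj (by simp) (by simp) hin
      exact huv (by rw [← sdiff_union_inter (E u) X, hout, hinter, sdiff_union_inter])
    · exact_mod_cast hg u v hout

theorem exists_sum_ne_of_card_sq_le (C : ℕ) : ∃ M₀ : ℕ, ∀ M ≥ M₀, ∀ (V ι : Type*) [Finite V]
    [Fintype ι] (E : ι → Finset V), Fintype.card ι ^ 2 ≤ C * M →
    ∃ f : V → ℕ, (∀ x, 0 < f x ∧ f x ≤ 2 * M) ∧
      ∀ u v, E u ≠ E v → ∑ x ∈ E u, f x ≠ ∑ x ∈ E v, f x := by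
  have hδ : 0 < Real.exp (-C) / 2 := by positivity
  obtain ⟨T, hT, hTδ⟩ : ∃ T : ℕ, 0 < T ∧ (C / (2 * T) : ℝ) < Real.exp (-C) / 2 := by
    have hlim : Tendsto (fun T : ℕ => (C / (2 * T) : ℝ)) atTop (nhds 0) :=
      tendsto_const_nhds.div_atTop (tendsto_natCast_atTop_atTop.const_mul_atTop two_pos)
    exact ((eventually_gt_atTop 0).and (hlim.eventually_lt_const hδ)).exists
  obtain ⟨h, hh, hhδ⟩ : ∃ h : ℕ, 0 < h ∧
      ∀ k ≥ h, (C * (k.centralBinom / 4 ^ k) : ℝ) < Real.exp (-C) / 2 := by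
    have hlim := tendsto_centralBinom_div_four_pow.const_mul (C : ℝ)
    rw [mul_zero] at hlim
    obtain ⟨h, hh⟩ := eventually_atTop.1 (hlim.eventually_lt_const hδ)
    exact ⟨h + 1, h.succ_pos, fun k hk => hh k (by lia)⟩
  let D : ℕ → ℕ := fun i => 2 * (h * (C + 1) ^ i)
  have hD : Monotone D := fun i j hij => by
    dsimp only [D]
    gcongr
    lia
  refine ⟨2 ^ (C * D T), fun M hMD V ι _ _ E hCM => ?_⟩
  classical
  obtain ⟨i, hiT, hmid⟩ := exists_mul_card_pairsAtDist_Ioc_le E hD hT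
  have hDsucc : D (i + 1) = (C + 1) * D i := by dsimp only [D]; ring
  have hpow : 2 ^ (C * D i) ≤ M :=
    (Nat.pow_le_pow_right two_pos (Nat.mul_le_mul_left C (hD hiT.le))).trans hMD
  have hchoose : (C * ((D i).choose (D i / 2) / 2 ^ D i) : ℝ) < Real.exp (-C) / 2 := by
    have hle : h ≤ h * (C + 1) ^ i := Nat.le_mul_of_pos_right h (by positivity)
    have hfour : (2 : ℝ) ^ D i = 4 ^ (h * (C + 1) ^ i) := by rw [pow_mul]; norm_num
    rw [hfour]
    simpa [D, Nat.centralBinom_eq_two_mul_choose] using hhδ _ hle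
  rw [hDsucc] at hmid
  exact exists_labeling_sum_ne ((Nat.two_pow_pos _).trans_le hpow) (by positivity) hT hCM
    (by lia) hmid (by linarith)

theorem mem_closedNeighborhood {V : Type*} [Fintype V] {G : SimpleGraph V} {u v : V} :
    u ∈ closedNeighborhood G v ↔ u = v ∨ G.Adj v u := by
  simp [closedNeighborhood]

theorem sStarGraph_le_sStar {n : ℕ} (G : SimpleGraph (Fin n)) : sStarGraph G ≤ sStar n := by
  classical
  exact le_sup (f := sStarGraph) (mem_univ G)

theorem sStarGraph_le {V : Type*} [Fintype V] [Nonempty V] {G : SimpleGraph V} {k : ℕ} {f : V → ℕ}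
    (hf : IsVertexSumDistinguishing G f) (hk : ∀ v, f v ≤ k) : sStarGraph G ≤ k := by
  obtain ⟨v, hv⟩ := Finite.exists_max f
  exact ((sStarGraph_isLeast G).2 ⟨f, hf, Set.mem_range_self v, Set.forall_mem_range.2 hv⟩).trans
    (hk v)

theorem sStar_pos {n : ℕ} (hn : 0 < n) : 0 < sStar n := by
  have : Nonempty (Fin n) := ⟨⟨0, hn⟩⟩
  obtain ⟨f, hf, ⟨v, hv⟩, -⟩ := (sStarGraph_isLeast (⊥ : SimpleGraph (Fin n))).1
  exact (hv ▸ hf.1 v).trans_le (sStarGraph_le_sStar _)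

theorem eventually_sStar_le {C : ℝ} (hC : 0 < C) :
    ∀ᶠ n : ℕ in atTop, (sStar n : ℝ) ≤ (n : ℝ) ^ 2 / C := by
  obtain ⟨M₀, hM₀⟩ := exists_sum_ne_of_card_sq_le ⌈4 * C⌉₊
  have hlim : Tendsto (fun n : ℕ => (n : ℝ) ^ 2 / (2 * C)) atTop atTop :=
    ((tendsto_pow_atTop two_ne_zero).comp tendsto_natCast_atTop_atTop).atTop_div_const
      (by positivity)
  filter_upwards [eventually_gt_atTop 0, hlim.eventually_ge_atTop (max M₀ 1)] with n hn hlarge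
  have : Nonempty (Fin n) := ⟨⟨0, hn⟩⟩
  set x := (n : ℝ) ^ 2 / (2 * C) with hx
  have hM₀x : M₀ ≤ ⌊x⌋₊ := Nat.le_floor ((le_max_left _ _).trans hlarge)
  have hhalf : x ≤ 2 * ⌊x⌋₊ := by
    have hone : (1 : ℝ) ≤ ⌊x⌋₊ := by
      exact_mod_cast Nat.le_floor (by simpa using (le_max_right _ _).trans hlarge)
    linarith [Nat.lt_floor_add_one x]
  have hsq : n ^ 2 ≤ ⌈4 * C⌉₊ * ⌊x⌋₊ := by
    rify
    calc (n : ℝ) ^ 2 = 2 * C * x := by rw [hx]; field_simp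
      _ ≤ 2 * C * (2 * ⌊x⌋₊) := by gcongr
      _ = 4 * C * ⌊x⌋₊ := by ring
      _ ≤ ⌈4 * C⌉₊ * ⌊x⌋₊ := by gcongr; exact Nat.le_ceil _
  have hupper : sStar n ≤ 2 * ⌊x⌋₊ := Finset.sup_le fun G _ => by
    obtain ⟨f, hf, hdist⟩ := hM₀ _ hM₀x (Fin n) (Fin n) (closedNeighborhood G) (by simpa using hsq)
    exact sStarGraph_le ⟨fun v => (hf v).1, hdist⟩ fun v => (hf v).2
  calc (sStar n : ℝ) ≤ 2 * ⌊x⌋₊ := by exact_mod_cast hupper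
    _ ≤ 2 * x := by gcongr; exact Nat.floor_le (by positivity)
    _ = (n : ℝ) ^ 2 / C := by rw [hx]; field_simp

section Colorings

variable {U β Q : Type*} [Fintype U] [Fintype Q]

open Classical in
-- If `g` is injective on the class of `j`, then `u` and `u'` do not both have the colour `j`.
theorem card_filter_injOn_le_mul [DecidableEq U] (g : U → β) (j : Q) {u u' : U} (hne : u ≠ u')
    (hg : g u = g u') :
    #{c : U → Q | Set.InjOn g (c ⁻¹' {j})} ≤ (Fintype.card Q ^ 2 - 1) *
      #{c : {x // x ≠ u ∧ x ≠ u'} → Q | Set.InjOn (g ∘ Subtype.val) (c ⁻¹' {j})} := by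
  rw [sq, ← Fintype.card_prod, ← card_singleton (j, j), ← card_compl, ← card_product]
  refine card_le_card_of_injOn (fun c => ((c u, c u'), fun x => c x)) ?_ ?_
  · intro c hc
    have hc : Set.InjOn g (c ⁻¹' {j}) := by simpa using hc
    simp only [coe_product, Set.mem_prod, mem_coe, mem_compl, mem_singleton, Prod.mk.injEq,
      mem_filter, mem_univ, true_and]
    exact ⟨fun h => hne (hc h.1 h.2 hg), fun x hx y hy hxy => Subtype.ext (hc hx hy hxy)⟩
  · intro c _ c' _ h
    simp only [Prod.mk.injEq] at h
    funext x
    obtain rfl | hx := eq_or_ne x u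
    · exact h.1.1
    obtain rfl | hx' := eq_or_ne x u'
    · exact h.1.2
    exact congrFun h.2 ⟨x, hx, hx'⟩

open Classical in
theorem card_filter_injOn_le [DecidableEq U] [Fintype β] (g : U → β) (j : Q) {t : ℕ}
    (hU : Fintype.card U = Fintype.card β + 2 * t) :
    #{c : U → Q | Set.InjOn g (c ⁻¹' {j})} ≤
      Fintype.card Q ^ Fintype.card β * (Fintype.card Q ^ 2 - 1) ^ t := by
  induction t generalizing U with
  | zero =>
    have hcard : Fintype.card U = Fintype.card β := hU
    simpa [hcard] using card_le_univ {c : U → Q | Set.InjOn g (c ⁻¹' {j})}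
  | succ t ih =>
    obtain ⟨u, u', hne, hg⟩ := Fintype.exists_ne_map_eq_of_card_lt g (by lia)
    have hW : Fintype.card {x // x ≠ u ∧ x ≠ u'} = Fintype.card β + 2 * t := by
      have hcompl : ({x | x ≠ u ∧ x ≠ u'} : Finset U) = {u, u'}ᶜ := by ext; simp
      rw [Fintype.card_subtype, hcompl, card_compl, card_pair hne]
      lia
    refine (card_filter_injOn_le_mul g j hne hg).trans ?_
    refine (Nat.mul_le_mul_left _ (ih (g ∘ Subtype.val) hW)).trans_eq ?_
    ring

-- Colour `U` at random: with positive probability no `g φ` is injective on any colour class, and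
-- then the smallest colour class will do.
theorem exists_finset_forall_not_injOn {Φ : Type*} [Fintype Φ] [Fintype β] (g : Φ → U → β)
    {q t : ℕ} (hq : 0 < q) (hU : Fintype.card U = Fintype.card β + 2 * t)
    (h : Fintype.card Φ * q * (q ^ 2 - 1) ^ t < (q ^ 2) ^ t) :
    ∃ s : Finset U, q * #s ≤ Fintype.card U ∧ ∀ φ, ¬ Set.InjOn (g φ) s := by
  classical
  have : Nonempty (Fin q) := ⟨⟨0, hq⟩⟩
  let bad : Φ × Fin q → Finset (U → Fin q) := fun p =>
    {c | Set.InjOn (g p.1) (c ⁻¹' {p.2})}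
  have hbad (p : Φ × Fin q) : #(bad p) ≤ q ^ Fintype.card β * (q ^ 2 - 1) ^ t := by
    simpa using card_filter_injOn_le (g p.1) p.2 hU
  have hlt : #(univ.biUnion bad) < #(univ : Finset (U → Fin q)) := by
    calc #(univ.biUnion bad) ≤ Fintype.card Φ * q * (q ^ Fintype.card β * (q ^ 2 - 1) ^ t) := by
          simpa using card_biUnion_le_card_mul univ bad _ fun p _ => hbad p
      _ = q ^ Fintype.card β * (Fintype.card Φ * q * (q ^ 2 - 1) ^ t) := by ring
      _ < q ^ Fintype.card β * (q ^ 2) ^ t := Nat.mul_lt_mul_of_pos_left h (by positivity)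
      _ = #(univ : Finset (U → Fin q)) := by simp [hU, pow_add, pow_mul]
  obtain ⟨c, -, hc⟩ := exists_mem_notMem_of_card_lt_card hlt
  obtain ⟨j, hj⟩ := Fintype.exists_card_fiber_le_of_card_le_nsmul c
    (b := (Fintype.card U / q : ℚ)) (by rw [Fintype.card_fin, nsmul_eq_mul]; field_simp; rfl)
  refine ⟨({x | c x = j} : Finset U), ?_, fun φ hinj => hc ?_⟩
  · rw [le_div_iff₀' (by positivity)] at hj
    exact_mod_cast hj
  · exact mem_biUnion.2 ⟨(φ, j), mem_univ _, by simpa [bad, Set.preimage] using hinj⟩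

end Colorings

theorem exists_finset_forall_not_injOn_sum {α : Type*} [Fintype α] {N R q : ℕ} (hq : 0 < q)
    (hN : Fintype.card α * N < R) (hR : 3 * R ≤ 2 ^ Fintype.card α)
    (h : (N + 1) ^ Fintype.card α * q * (q ^ 2 - 1) ^ R < (q ^ 2) ^ R) :
    ∃ F : Finset (Finset α), q * #F ≤ 3 * R ∧ ∀ f : α → ℕ, (∀ x, f x ≤ N) →
      ¬ Set.InjOn (fun e => ∑ x ∈ e, f x) (F : Set (Finset α)) := by
  classical
  obtain ⟨U, -, hU⟩ := exists_subset_card_eq (s := (univ : Finset (Finset α))) (n := 3 * R)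
    (by simpa using hR)
  have hsum (f : α → Fin (N + 1)) (e : Finset α) : ∑ x ∈ e, (f x : ℕ) < R := by
    calc ∑ x ∈ e, (f x : ℕ) ≤ #e * N := by
          simpa using sum_le_card_nsmul e _ N fun x _ => Nat.lt_succ_iff.1 (f x).2
      _ ≤ Fintype.card α * N := Nat.mul_le_mul_right _ (card_le_univ e)
      _ < R := hN
  let g : (α → Fin (N + 1)) → U → Fin R := fun f e => ⟨∑ x ∈ e.1, (f x : ℕ), hsum f e⟩
  obtain ⟨s, hs, hinj⟩ := exists_finset_forall_not_injOn g (t := R) hq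
    (by simp only [Fintype.card_coe, hU, Fintype.card_fin]; ring) (by simpa using h)
  refine ⟨s.map (.subtype _), by simpa [hU] using hs, fun f hf hF => ?_⟩
  refine hinj (fun x => ⟨f x, Nat.lt_succ_of_le (hf x)⟩) fun e he e' he' heq => ?_
  exact Subtype.ext (hF (by simpa using he) (by simpa using he') (by simpa [g] using heq))

theorem two_pow_mul_pred_pow_le {L m R : ℕ} (hm : 0 < m) (hR : L * m ≤ R) :
    2 ^ L * (m - 1) ^ R ≤ m ^ R := by
  have hbernoulli : 2 * (m - 1) ^ m ≤ m ^ m := by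
    obtain ⟨l, rfl⟩ := Nat.exists_eq_add_one.2 hm
    have h := pow_add_mul_le_add_pow (a := l) (b := 1) (Nat.zero_le _) (Nat.zero_le _) (l + 1)
    simp only [add_tsub_cancel_right, mul_one, Nat.cast_id] at h
    calc 2 * l ^ (l + 1) = l ^ (l + 1) + l * l ^ l := by ring
      _ ≤ (l + 1) ^ (l + 1) := by linarith [Nat.zero_le (l ^ l)]
  obtain ⟨r, rfl⟩ := Nat.exists_eq_add_of_le hR
  calc 2 ^ L * (m - 1) ^ (L * m + r) = (2 * (m - 1) ^ m) ^ L * (m - 1) ^ r := by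
        rw [pow_add, mul_comm L, pow_mul]; ring
    _ ≤ (m ^ m) ^ L * m ^ r := by gcongr; exact m.sub_le 1
    _ = m ^ (L * m + r) := by rw [pow_add, mul_comm L, pow_mul]

theorem mul_pred_pow_lt_pow {a L m R : ℕ} (ha : a < 2 ^ L) (hm : 0 < m) (hR : L * m ≤ R) :
    a * (m - 1) ^ R < m ^ R := by
  obtain h | h := ((m - 1) ^ R).eq_zero_or_pos
  · rw [h, mul_zero]; positivity
  · exact (Nat.mul_lt_mul_of_pos_right ha h).trans_le (two_pow_mul_pred_pow_le hm hR)

/-- The graph on `α ⊕ F` in which the members of the set family `F` form a clique and each of them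
is adjacent to its elements, so that the closed neighbourhoods of the members differ only by the
members themselves. -/
def familyGraph {α : Type*} (F : Finset (Finset α)) : SimpleGraph (α ⊕ F) where
  Adj
    | .inl _, .inl _ => False
    | .inl x, .inr e => x ∈ e.1
    | .inr e, .inl x => x ∈ e.1
    | .inr e, .inr e' => e ≠ e'
  symm := ⟨by
    rintro (x | e) (y | e') h
    exacts [h, h, h, h.symm]⟩
  loopless := ⟨by
    rintro (x | e) h
    exacts [h, h rfl]⟩

theorem closedNeighborhood_familyGraph {α : Type*} [Fintype α] (F : Finset (Finset α)) (e : F) :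
    closedNeighborhood (familyGraph F) (.inr e) = e.1.disjSum univ := by
  ext (x | e')
  · simp [mem_closedNeighborhood, familyGraph]
  · simpa [mem_closedNeighborhood, familyGraph, eq_comm] using em (e' = e)

theorem closedNeighborhood_map {W V : Type*} [Fintype W] [Fintype V] (G : SimpleGraph W)
    (i : W ↪ V) (w : W) :
    closedNeighborhood (G.map i) (i w) = (closedNeighborhood G w).map i := by
  ext v
  simp only [mem_closedNeighborhood, Finset.mem_map, SimpleGraph.map_adj]
  constructor
  · rintro (rfl | ⟨a, b, hab, ha, rfl⟩)
    · exact ⟨w, .inl rfl, rfl⟩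
    · obtain rfl := i.injective ha
      exact ⟨b, .inr hab, rfl⟩
  · rintro ⟨a, rfl | ha, rfl⟩
    · exact .inl rfl
    · exact .inr ⟨w, a, ha, rfl, rfl⟩

theorem lt_sStar_of_forall_not_injOn_sum {α : Type*} [Fintype α] {N n : ℕ}
    {F : Finset (Finset α)} (hn : Fintype.card α + #F ≤ n)
    (hF : ∀ f : α → ℕ, (∀ x, f x ≤ N) →
      ¬ Set.InjOn (fun e => ∑ x ∈ e, f x) (F : Set (Finset α))) : N < sStar n := by
  obtain ⟨i⟩ : Nonempty (α ⊕ F ↪ Fin n) :=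
    Function.Embedding.nonempty_of_card_le (by simpa using hn)
  let G := (familyGraph F).map i
  have hnbhd (e : F) : closedNeighborhood G (i (.inr e)) = (e.1.disjSum univ).map i := by
    rw [closedNeighborhood_map, closedNeighborhood_familyGraph]
  by_contra! hle
  obtain rfl | hpos := n.eq_zero_or_pos
  · have hempty : F = ∅ := card_eq_zero.1 (by lia)
    exact hF 0 (fun _ => Nat.zero_le _) (by simp [hempty])
  have : Nonempty (Fin n) := ⟨⟨0, hpos⟩⟩
  obtain ⟨f, ⟨-, hf⟩, hmax⟩ := (sStarGraph_isLeast G).1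
  have hfN (v : Fin n) : f v ≤ N :=
    (hmax.2 (Set.mem_range_self v)).trans ((sStarGraph_le_sStar G).trans hle)
  refine hF (fun x => f (i (.inl x))) (fun x => hfN _) fun e he e' he' hsum => ?_
  by_contra hne
  refine hf (i (.inr ⟨e, he⟩)) (i (.inr ⟨e', he'⟩)) ?_ ?_
  · rw [hnbhd, hnbhd]
    intro h
    have hdisj : e.disjSum univ = e'.disjSum univ := map_injective i h
    exact hne (ext fun x => by simpa using Finset.ext_iff.1 hdisj (.inl x))
  · simpa only [closedSum, hnbhd, sum_map, sum_disjSum, Nat.add_right_cancel_iff] using hsum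

theorem lt_sStar {k q n : ℕ} (hq : 0 < q) (hn : 4 * (k + 1) ^ 2 * q ≤ n) (hk : n ^ 2 ≤ 2 ^ k) :
    (k + 1) * q ^ 2 < sStar n := by
  set R := k * ((k + 1) * q ^ 2) + 1 with hR
  have hRn : 3 * R ≤ n ^ 2 := by
    calc 3 * R ≤ (4 * (k + 1) ^ 2 * q) ^ 2 := by
          have : 1 ≤ q ^ 2 := Nat.one_le_pow _ _ hq
          nlinarith [Nat.zero_le (k * q ^ 2), Nat.zero_le (k ^ 2 * q ^ 2),
            Nat.zero_le (k ^ 3 * q ^ 2), Nat.zero_le (k ^ 4 * q ^ 2)]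
      _ ≤ n ^ 2 := by gcongr
  have hk0 : 0 < k := by
    by_contra! h
    obtain rfl := Nat.le_zero.1 h
    nlinarith
  have hcount : ((k + 1) * q ^ 2 + 1) ^ k * q * (q ^ 2 - 1) ^ R < (q ^ 2) ^ R := by
    have hlabel : (k + 1) * q ^ 2 + 1 ≤ 2 ^ k := by
      have := Nat.le_mul_of_pos_left ((k + 1) * q ^ 2) hk0
      lia
    have hqk : q < 2 ^ k := by
      have := Nat.le_self_pow two_ne_zero q
      have := Nat.le_mul_of_pos_left (q ^ 2) k.succ_pos
      lia
    refine mul_pred_pow_lt_pow (L := k * (k + 1)) ?_ (by positivity) (by lia)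
    calc ((k + 1) * q ^ 2 + 1) ^ k * q < (2 ^ k) ^ k * 2 ^ k :=
          Nat.mul_lt_mul_of_le_of_lt (by gcongr) hqk (by positivity)
      _ = 2 ^ (k * (k + 1)) := by ring
  obtain ⟨F, hF, hinj⟩ := exists_finset_forall_not_injOn_sum (α := Fin k) (N := (k + 1) * q ^ 2)
    (R := R) hq (by simp [hR]) (by simpa using hRn.trans hk) (by simpa using hcount)
  refine lt_sStar_of_forall_not_injOn_sum ?_ hinj
  refine Nat.le_of_mul_le_mul_left ?_ hq
  rw [Fintype.card_fin]
  calc q * (k + #F) ≤ q * k + 3 * R := by lia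
    _ ≤ q * (4 * (k + 1) ^ 2 * q) := by
        have : 1 ≤ q ^ 2 := Nat.one_le_pow _ _ hq
        nlinarith [Nat.zero_le (k ^ 2 * q ^ 2),
          Nat.mul_le_mul_left k (Nat.le_self_pow two_ne_zero q)]
    _ ≤ q * n := by gcongr

theorem isLittleO_rpow_rpow_atTop {a b : ℝ} (hab : a < b) :
    (fun x : ℝ => x ^ a) =o[atTop] fun x : ℝ => x ^ b := by
  refine isLittleO_of_tendsto' ?_ ((tendsto_rpow_neg_atTop (sub_pos.2 hab)).congr' ?_)
  · filter_upwards [eventually_gt_atTop 0] with x hx h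
    exact absurd h (Real.rpow_pos_of_pos hx b).ne'
  · filter_upwards [eventually_gt_atTop 0] with x hx
    rw [← Real.rpow_sub hx, neg_sub]

theorem eventually_const_mul_natLog_pow_le_rpow (a : ℝ) (b j : ℕ) {ε : ℝ} (hε : 0 < ε) :
    ∀ᶠ n : ℕ in atTop, a * (Nat.log b n : ℝ) ^ j ≤ (n : ℝ) ^ ε := by
  have hlittle : (fun n : ℕ => Real.log n ^ j) =o[atTop] fun n : ℕ => (n : ℝ) ^ ε := by
    simpa only [Function.comp_def, Real.rpow_natCast] using
      (isLittleO_log_rpow_rpow_atTop (j : ℝ) hε).comp_tendsto tendsto_natCast_atTop_atTop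
  have hlog : (fun n : ℕ => (Nat.log b n : ℝ)) =O[atTop] fun n : ℕ => Real.log n := by
    refine .of_bound (Real.log b)⁻¹ (.of_forall fun n => ?_)
    rw [Real.norm_of_nonneg (Nat.cast_nonneg _), Real.norm_of_nonneg (Real.log_natCast_nonneg n),
      inv_mul_eq_div]
    exact Real.natLog_le_logb n b
  filter_upwards [(((hlog.pow j).trans_isLittleO hlittle).const_mul_left a).bound one_pos]
    with n hn
  rw [one_mul] at hn
  exact (le_abs_self _).trans (hn.trans_eq (Real.norm_of_nonneg (by positivity)))

theorem sq_le_natLog_pow_mul_sStar {n : ℕ} (hn : 2 ≤ n) (hlog : 100 * Nat.log 2 n ^ 2 ≤ n) :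
    n ^ 2 ≤ 8000 * Nat.log 2 n ^ 3 * sStar n := by
  set k := 2 * (Nat.log 2 n + 1) with hk
  set q := n / (4 * (k + 1) ^ 2)
  have hklog : k + 1 ≤ 5 * Nat.log 2 n := by
    have := Nat.log_pos one_lt_two hn
    lia
  have hkn : 4 * (k + 1) ^ 2 ≤ n := by
    calc 4 * (k + 1) ^ 2 ≤ 4 * (5 * Nat.log 2 n) ^ 2 := by gcongr
      _ = 100 * Nat.log 2 n ^ 2 := by ring
      _ ≤ n := hlog
  have hq : 0 < q := Nat.div_pos hkn (by positivity)
  have hnq : n ≤ 8 * (k + 1) ^ 2 * q := by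
    have hlt : n < q * (4 * (k + 1) ^ 2) + 4 * (k + 1) ^ 2 := Nat.lt_div_mul_add (by positivity)
    have hle : 4 * (k + 1) ^ 2 ≤ 4 * (k + 1) ^ 2 * q := Nat.le_mul_of_pos_right _ hq
    linarith
  have hpow : n ^ 2 ≤ 2 ^ k := by
    rw [hk, pow_mul']
    gcongr
    exact (Nat.lt_pow_succ_log_self one_lt_two n).le
  calc n ^ 2 ≤ (8 * (k + 1) ^ 2 * q) ^ 2 := by gcongr
    _ = 64 * (k + 1) ^ 3 * ((k + 1) * q ^ 2) := by ring
    _ ≤ 64 * (5 * Nat.log 2 n) ^ 3 * sStar n := by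
        gcongr
        exact (lt_sStar hq (Nat.mul_div_le _ _) hpow).le
    _ = 8000 * Nat.log 2 n ^ 3 * sStar n := by ring

theorem eventually_rpow_le_sStar {ε : ℝ} (hε : 0 < ε) :
    ∀ᶠ n : ℕ in atTop, (n : ℝ) ^ (2 - ε) ≤ (sStar n : ℝ) := by
  filter_upwards [eventually_const_mul_natLog_pow_le_rpow 8000 2 3 hε,
    eventually_const_mul_natLog_pow_le_rpow 100 2 2 one_pos, eventually_ge_atTop 2]
    with n hcube hsq hn
  rw [Real.rpow_one] at hsq
  have hn0 : (0 : ℝ) < n := by positivity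
  refine le_of_mul_le_mul_left ?_ (Real.rpow_pos_of_pos hn0 ε)
  calc (n : ℝ) ^ ε * (n : ℝ) ^ (2 - ε) = (n : ℝ) ^ 2 := by
        rw [← Real.rpow_add hn0, add_sub_cancel, Real.rpow_two]
    _ ≤ 8000 * Nat.log 2 n ^ 3 * sStar n := by
        exact_mod_cast sq_le_natLog_pow_mul_sStar hn (by exact_mod_cast hsq)
    _ ≤ (n : ℝ) ^ ε * sStar n := by gcongr

theorem tendsto_sq_div_sStar_atTop :
    Tendsto (fun n : ℕ => (n : ℝ) ^ 2 / sStar n) atTop atTop := by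
  refine tendsto_atTop.2 fun b => ?_
  have hC : (0 : ℝ) < max b 1 := lt_max_of_lt_right one_pos
  filter_upwards [eventually_sStar_le hC, eventually_gt_atTop 0] with n hle hn
  have hs : (0 : ℝ) < sStar n := by exact_mod_cast sStar_pos hn
  exact (le_max_left b 1).trans ((le_div_comm₀ hs hC).1 hle)

theorem sq_div_sStar_isLittleO_rpow {ε : ℝ} (hε : 0 < ε) :
    (fun n : ℕ => (n : ℝ) ^ 2 / sStar n) =o[atTop] fun n : ℕ => (n : ℝ) ^ ε := by
  have hlittle : (fun n : ℕ => (n : ℝ) ^ (ε / 2)) =o[atTop] fun n : ℕ => (n : ℝ) ^ ε :=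
    (isLittleO_rpow_rpow_atTop (half_lt_self hε)).comp_tendsto tendsto_natCast_atTop_atTop
  refine IsBigO.trans_isLittleO (.of_bound' ?_) hlittle
  filter_upwards [eventually_rpow_le_sStar (half_pos hε), eventually_gt_atTop 0] with n hle hn
  have hs : (0 : ℝ) < sStar n := by exact_mod_cast sStar_pos hn
  have hn0 : (0 : ℝ) < n := by exact_mod_cast hn
  rw [Real.norm_of_nonneg (by positivity), Real.norm_of_nonneg (by positivity), div_le_iff₀ hs]
  calc (n : ℝ) ^ 2 = (n : ℝ) ^ (ε / 2) * (n : ℝ) ^ (2 - ε / 2) := by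
        rw [← Real.rpow_add hn0, add_sub_cancel, Real.rpow_two]
    _ ≤ (n : ℝ) ^ (ε / 2) * sStar n := by gcongr

end SumDistinguishing

theorem corollary2 :
    (∀ C : ℝ, 0 < C → ∀ ε : ℝ, 0 < ε → ∃ n₀ : ℕ, ∀ n : ℕ, n₀ < n →
      (n : ℝ) ^ (2 - ε) ≤ (SumDistinguishing.sStar n : ℝ) ∧
        (SumDistinguishing.sStar n : ℝ) ≤ (n : ℝ) ^ 2 / C) ∧
    (∃ w : ℕ → ℝ,
      (∀ n : ℕ, 0 < n → 0 < w n ∧ (SumDistinguishing.sStar n : ℝ) = (n : ℝ) ^ 2 / w n) ∧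
      Tendsto w atTop atTop ∧
      ∀ ε : ℝ, 0 < ε → w =o[atTop] (fun n : ℕ => (n : ℝ) ^ ε)) := by
  refine ⟨fun C hC ε hε => ?_, fun n => (n : ℝ) ^ 2 / SumDistinguishing.sStar n, fun n hn => ?_,
    SumDistinguishing.tendsto_sq_div_sStar_atTop,
    fun ε hε => SumDistinguishing.sq_div_sStar_isLittleO_rpow hε⟩
  · obtain ⟨n₀, hn₀⟩ := eventually_atTop.1 ((SumDistinguishing.eventually_rpow_le_sStar hε).and
      (SumDistinguishing.eventually_sStar_le hC))
    exact ⟨n₀, fun n hn => hn₀ n hn.le⟩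
  · have hs : (0 : ℝ) < SumDistinguishing.sStar n := by
      exact_mod_cast SumDistinguishing.sStar_pos hn
    exact ⟨by positivity, by field_simp⟩
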